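/- **Setting.** Let $\mathcal N$ be a finite set of users, let $\mathcal K$ be a finite non-empty set of channels, and let $G$ be an undirected simple graph on $\mathcal N$. Write $\mathcal I_n$ for the set of neighbours of user $n$ in $G$. Let $u_n(k)\ge 0$ be the collision-free rate of user $n$ on channel $k$. Each user uses one channel ($M=1$). A strategy profile is $\sigma=(k_n,p_n)_{n\in\mathcal N}$ with $k_n\in\mathcal K$ and $0\le p_n\le 1$. Put $$\mathcal I_n(k)=\{i\in\mathcal I_n: k_i=k\},\qquad v_n(k,\sigma_{-n})=\prod_{i\in\mathcal I_n(k)}(1-p_i),\qquad R_n(\sigma)=p_n\,u_n(k_n)\,v_n(k_n,\sigma_{-n}),\qquad I_n(k,\sigma_{-n})=-\log v_n(k,\sigma_{-n}).$$ Logarithms take values in $[-\infty,\infty)$ with $\log 0=-\infty$, and $0\cdot\infty=0$. The cooperative utility of user $n$ is $$F_n(k,p,\sigma_{-n})=\log\bigl(u_n(k)p\bigr)-I_n(k,\sigma_{-n})-\log\Bigl(\frac1{1-p}\Bigr)\,|\mathcal I_n(k)| .$$ Let $\Sigma^*$ be the set of proportionally fair profiles, that is, the maximisers of $\sum_n\log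 R_n(\sigma)$ over all profiles with $k_n\in\mathcal K$ and $0\le p_n\le1$. **The NBRF algorithm with parameter $\beta>0$.** Initially each user $n$ chooses a channel $k_n\in\arg\max_k u_n(k)$ (ties broken in any way) and sets $p_n=1/(|\mathcal I_n(k_n)|+1)$. At each updating time $t=1,2,\dots$: - All users draw fresh independent backoff times, uniform on $[0,B]$ for a fixed $B>0$. A user becomes active when its backoff time expires, unless one of its neighbours has already become active at this updating time. - The active users independently draw new strategies $(k,p)$ with $k\in\mathcal K$ and $p\in\{1,\frac12,\dots,\frac1{|\mathcal I_n|+1}\}$, where user $n$ uses the probabilities $$\Pr\bigl((k_n,p_n)=(k,p)\bigr)=\frac{e^{\beta F_n(k,p,\sigma_{-n})}}{\sum_{k'\in\mathcal K}\sum_{r=1}^{|\mathcal I_n|+1}e^{\beta F_n(k',1/r,\sigma_{-n})}}$$ with $e^{-\infty}=0$. If the denominator is $0$, the user keeps its strategy; along a run this happens only to a user with $u_n\equiv 0$. - All other users keep their strategies. Let $\sigma^{\mathrm{NBRF}(\beta)}(t)$ be the resulting random profile after $t$ updating times. **Theorem.** For every $\varepsilon>0$ there is a $\beta>0$ such that,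 for every choice of the initial maximising channels, the limit below exists and $$\lim_{t\to\infty}\Pr\bigl(\sigma^{\mathrm{NBRF}(\beta)}(t)\in\Sigma^*\bigr)\ \ge\ 1-\varepsilon .$$ -/

import Mathlib

open MeasureTheory ProbabilityTheory Filter Topology
open scoped ENNReal

set_option linter.unusedSectionVars false

noncomputable section

namespace AlohaFairness

variable {V C : Type*} [Fintype V] [DecidableEq V] [Fintype C] [DecidableEq C]

/-! ### The fairness game (each user picks one channel and an attempt probability)

`V` is the set of users, `C` the set of channels, `G` the interference graph, and `u n k` the
collision-free rate of user `n` on channel `k`.  Logarithms take values in `[-∞, ∞]`, with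
`log 0 = -∞` and `0 * ∞ = 0`. -/

/-- A strategy profile: user `n` plays `σ n = (k_n, p_n)`. -/
abbrev Profile (V C : Type*) := V → C × ℝ

/-- The extended logarithm of a nonnegative real number. -/
def elog (x : ℝ) : EReal := ENNReal.log (ENNReal.ofReal x)

/-- The set `I_n(k)` of the neighbours of `n` that use channel `k`. -/
def neighborsOn (G : SimpleGraph V) [DecidableRel G.Adj] (σ : Profile V C) (n : V) (k : C) :
    Finset V :=
  (G.neighborFinset n).filter fun i => (σ i).1 = k

/-- The success probability `v_n(k, σ_{-n})`, the product of `(1 - p_i) ^ 1{k_i = k}` over the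
neighbours `i` of `n`. -/
def successProb (G : SimpleGraph V) [DecidableRel G.Adj] (σ : Profile V C) (n : V) (k : C) : ℝ :=
  ∏ i ∈ G.neighborFinset n, (1 - (σ i).2) ^ (if (σ i).1 = k then 1 else 0)

/-- The expected rate `R_n(σ) = p_n u_n(k_n) v_n(k_n, σ_{-n})`. -/
def rate (G : SimpleGraph V) [DecidableRel G.Adj] (u : V → C → ℝ) (σ : Profile V C) (n : V) : ℝ :=
  (σ n).2 * u n (σ n).1 * successProb G σ n (σ n).1

/-- The log-interference `I_n(k, σ_{-n}) = - log v_n(k, σ_{-n})`. -/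
def logInterference (G : SimpleGraph V) [DecidableRel G.Adj] (σ : Profile V C) (n : V) (k : C) :
    EReal :=
  -elog (successProb G σ n k)

/-- The cooperative utility `F_n(k, p, σ_{-n})`; the entry `σ n` is not used. -/
def coopUtility (G : SimpleGraph V) [DecidableRel G.Adj] (u : V → C → ℝ) (σ : Profile V C)
    (n : V) (k : C) (p : ℝ) : EReal :=
  elog (u n k * p) - logInterference G σ n k
    - ENNReal.log (1 / ENNReal.ofReal (1 - p)) * ((neighborsOn G σ n k).card : EReal)

/-- The sum of the log-rates. -/
def sumLogRate (G : SimpleGraph V) [DecidableRel G.Adj] (u : V → C → ℝ) (σ : Profile V C) :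
    EReal :=
  ∑ n, elog (rate G u σ n)

/-- The profiles whose attempt probabilities lie in `[0, 1]`. -/
def feasible (V C : Type*) : Set (Profile V C) := {σ | ∀ n, 0 ≤ (σ n).2 ∧ (σ n).2 ≤ 1}

/-- The proportionally fair profiles: maximisers of the sum of log-rates over all channel choices
and all attempt probabilities in `[0, 1]`. -/
def propFairOptima (G : SimpleGraph V) [DecidableRel G.Adj] (u : V → C → ℝ) :
    Set (Profile V C) :=
  {σ | σ ∈ feasible V C ∧ IsMaxOn (sumLogRate G u) (feasible V C) σ}

/-! ### Noisy best response -/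

/-- The actions of user `n` in the algorithm: `(k, r)` stands for the strategy
`(k, 1 / (r + 1))`, where `r + 1` ranges over `1, …, |I_n| + 1`. -/
abbrev Action (C : Type*) (G : SimpleGraph V) [DecidableRel G.Adj] (n : V) : Type _ :=
  C × Fin (G.degree n + 1)

/-- The states of the algorithm: one action for every user. -/
abbrev State (C : Type*) (G : SimpleGraph V) [DecidableRel G.Adj] : Type _ :=
  (n : V) → Action C G n

/-- The strategy that an action stands for. -/
def toStrategy (G : SimpleGraph V) [DecidableRel G.Adj] (n : V) (a : Action C G n) : C × ℝ :=
  (a.1, 1 / ((a.2 : ℕ) + 1 : ℝ))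

/-- The strategy profile that a state stands for. -/
def toProfile (G : SimpleGraph V) [DecidableRel G.Adj] (s : State C G) : Profile V C :=
  fun n => toStrategy G n (s n)

/-- The weight `exp (β F_n(k, p, σ_{-n}))` of an action `(k, p)` of user `n`. -/
def weight (G : SimpleGraph V) [DecidableRel G.Adj] (u : V → C → ℝ) (β : ℝ) (s : State C G)
    (n : V) (a : Action C G n) : ℝ≥0∞ :=
  EReal.exp ((β : EReal) *
    coopUtility G u (toProfile G s) n (toStrategy G n a).1 (toStrategy G n a).2)

open Classical in
/-- The noisy best response of user `n`: an action is drawn with probability proportional to its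
weight.  If every action has weight `0` the user keeps its action (along a run of the algorithm
this happens only to a user whose rates `u n k` all vanish). -/
def noisyBR (G : SimpleGraph V) [DecidableRel G.Adj] (u : V → C → ℝ) (β : ℝ) (s : State C G)
    (n : V) : PMF (Action C G n) :=
  if h : (∑' a, weight G u β s n a) ≠ 0 ∧ (∑' a, weight G u β s n a) ≠ ∞ then
    PMF.normalize (weight G u β s n) h.1 h.2
  else PMF.pure (s n)

/-- The joint law of independent random elements with laws `q n`. -/
def piPMF {α : V → Type*} [∀ n, Fintype (α n)] (q : ∀ n, PMF (α n)) : PMF (∀ n, α n) :=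
  PMF.ofFintype (fun a => ∏ n, q n (a n)) (by
    rw [← Fintype.prod_sum (fun n x => q n x)]
    refine Finset.prod_eq_one fun n _ => ?_
    rw [← tsum_fintype (L := .unconditional _), (q n).tsum_coe])

/-- The users in `S` draw new actions independently, each by its noisy best response to the
current state; the others keep their actions. -/
def update (G : SimpleGraph V) [DecidableRel G.Adj] (u : V → C → ℝ) (β : ℝ) (s : State C G)
    (S : Finset V) : PMF (State C G) :=
  piPMF fun n => if n ∈ S then noisyBR G u β s n else PMF.pure (s n)

/-! ### The selection of the active users -/

theorem backoff_wf (b : V → ℝ) : WellFounded fun m n : V => b m < b n :=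
  have : IsTrans V fun m n : V => b m < b n := ⟨fun _ _ _ h h' => lt_trans h h'⟩
  have : Std.Irrefl fun m n : V => b m < b n := ⟨fun _ => lt_irrefl _⟩
  Finite.wellFounded_of_trans_of_irrefl _

/-- Given the backoff times `b`, user `n` is active when no neighbour became active before the
backoff time of `n` expired; see `isActive_iff`. -/
def IsActive (G : SimpleGraph V) (b : V → ℝ) : V → Prop :=
  (backoff_wf b).fix fun n ih => ∀ m, G.Adj n m → ∀ h : b m < b n, ¬ ih m h

theorem isActive_iff (G : SimpleGraph V) (b : V → ℝ) (n : V) :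
    IsActive G b n ↔ ∀ m, G.Adj n m → b m < b n → ¬ IsActive G b m := by
  rw [IsActive, WellFounded.fix_eq]

open Classical in
/-- The set of active users for the backoff times `b`. -/
def activeSet (G : SimpleGraph V) (b : V → ℝ) : Finset V := Finset.univ.filter (IsActive G b)

theorem activeSet_eq_iff (G : SimpleGraph V) (b : V → ℝ) (S : Finset V) :
    activeSet G b = S ↔ ∀ n, n ∈ S ↔ ∀ m, G.Adj n m → b m < b n → m ∉ S := by
  constructor
  · rintro rfl n
    simpa [activeSet] using isActive_iff G b n
  · intro h
    have key : ∀ n, IsActive G b n ↔ n ∈ S := fun n => by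
      induction n using (backoff_wf b).induction with
      | _ n ih =>
        rw [isActive_iff, h n]
        exact forall_congr' fun m => forall_congr' fun _ => forall_congr' fun hb =>
          not_congr (ih m hb)
    ext n
    simp [activeSet, key]

/-- Independent backoff times, each uniform on `[0, B]`. -/
def backoffMeasure (V : Type*) [Fintype V] (B : ℝ) : Measure (V → ℝ) :=
  Measure.pi fun _ => (volume : Measure ℝ)[|Set.Icc 0 B]

theorem isProbabilityMeasure_backoffMeasure {B : ℝ} (hB : 0 < B) :
    IsProbabilityMeasure (backoffMeasure V B) := by
  have : IsProbabilityMeasure ((volume : Measure ℝ)[|Set.Icc 0 B]) :=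
    cond_isProbabilityMeasure_of_finite (by simpa using hB) (by simp)
  unfold backoffMeasure
  infer_instance

theorem measurableSet_activeSet_eq (G : SimpleGraph V) (S : Finset V) :
    MeasurableSet {b : V → ℝ | activeSet G b = S} := by
  simp only [activeSet_eq_iff]
  refine measurableSet_setOfPred.2 (Measurable.forall fun n => Measurable.iff measurable_const ?_)
  refine Measurable.forall fun m => Measurable.imp measurable_const ?_
  exact Measurable.imp (measurableSet_setOfPred.1
    (measurableSet_lt (measurable_pi_apply m) (measurable_pi_apply n))) measurable_const

/-- The law of the set of active users at an updating time. -/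
def activeLaw (G : SimpleGraph V) {B : ℝ} (hB : 0 < B) : PMF (Finset V) :=
  PMF.ofFintype (fun S => backoffMeasure V B {b | activeSet G b = S}) (by
    have := isProbabilityMeasure_backoffMeasure (V := V) hB
    have h := measure_biUnion_finset (μ := backoffMeasure V B) (s := Finset.univ)
      (f := fun S : Finset V => {b : V → ℝ | activeSet G b = S})
      (fun S _ T _ hST => Set.disjoint_left.2 fun b hb hb' => hST (hb.symm.trans hb'))
      (fun S _ => measurableSet_activeSet_eq G S)
    rw [← h, show (⋃ S ∈ Finset.univ, {b : V → ℝ | activeSet G b = S}) = Set.univ by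
      ext b; simp]
    exact measure_univ)

/-! ### The algorithm -/

/-- The initial state: user `n` is on channel `k₀ n` with attempt probability
`1 / (|I_n(k₀ n)| + 1)`. -/
def initState (G : SimpleGraph V) [DecidableRel G.Adj] (k₀ : V → C) : State C G :=
  fun n => (k₀ n, ⟨((G.neighborFinset n).filter fun i => k₀ i = k₀ n).card,
    Nat.lt_succ_of_le (Finset.card_filter_le _ _)⟩)

/-- The law of the state after `t` updating times: at each updating time the set of active users
is drawn from fresh backoff times, and the active users play noisy best responses. -/
def stateLaw (G : SimpleGraph V) [DecidableRel G.Adj] (u : V → C → ℝ) {B : ℝ} (hB : 0 < B)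
    (β : ℝ) (k₀ : V → C) : ℕ → PMF (State C G)
  | 0 => PMF.pure (initState G k₀)
  | t + 1 => (stateLaw G u hB β k₀ t).bind fun s => (activeLaw G hB).bind (update G u β s)

/-- The law of the strategy profile after `t` updating times. -/
def profileLaw (G : SimpleGraph V) [DecidableRel G.Adj] (u : V → C → ℝ) {B : ℝ} (hB : 0 < B)
    (β : ℝ) (k₀ : V → C) (t : ℕ) : PMF (Profile V C) :=
  (stateLaw G u hB β k₀ t).map (toProfile G)

/-- The probability that the strategy profile at time `t` is proportionally fair. -/
def probOptimal (G : SimpleGraph V) [DecidableRel G.Adj] (u : V → C → ℝ) {B : ℝ} (hB : 0 < B)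
    (β : ℝ) (k₀ : V → C) (t : ℕ) : ℝ :=
  ((profileLaw G u hB β k₀ t).toOuterMeasure (propFairOptima G u)).toReal

end AlohaFairness

end

/-! The game has an exact potential. The product of all rates splits into one factor for each
ordered pair of neighbours, and the factors that involve user `n` multiply up to the exponential of
its cooperative utility. More generally, for an independent set `S` of users the product of the
rates is the product of these exponentials over `S` times a term blind to `S`
(`prod_rate_eq_mul_restRate`).

Adjacent users can both be active only if their backoff times tie, which has probability zero. So
the active users are almost surely independent, and their simultaneous noisy best responses satisfy
detailed balance for the Gibbs weight (product of rates)^β (`gibbs_mul_transition_comm`). From any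
state of positive weight one can lower all attempt probabilities to the smallest grid value and then
change channels freely. Hence a common aperiodic state is reachable, and the law converges to the
normalised Gibbs weight (`tendsto_of_reversible`, `tendsto_stateLaw`).

For large β this limit concentrates on the states that maximise the product of rates. The grid loses
nothing: for fixed channels the attempt probabilities decouple, and p(1-p)^c is largest at p =
1/(c+1), where c is a number of neighbours (`exists_prod_rate_le_prodRate`). -/

noncomputable section

namespace AlohaFairness

/-! ### Convergence of finite reversible chains -/

section Chain

open Matrix

variable {S : Type*} [Fintype S] [DecidableEq S]

/-- Doeblin contraction. As `d` has total mass zero, subtracting `δ` from column `s₀` does not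
change the product; the remaining entries are nonnegative on the support of `d`, with row sums `1 -
δ`. Only rows in that support need the lower bound, so states of zero weight do no harm. -/
theorem sum_abs_vecMul_le_of_minorized {Q : Matrix S S ℝ} (hQ : Q ∈ rowStochastic ℝ S)
    {d : S → ℝ} (hd : ∑ i, d i = 0) {s₀ : S} {δ : ℝ} (hδ : ∀ i, d i ≠ 0 → δ ≤ Q i s₀) :
    ∑ j, |(d ᵥ* Q) j| ≤ (1 - δ) * ∑ i, |d i| := by
  have hsum : ∀ i, ∑ j, Q i j = 1 := sum_row_of_mem_rowStochastic hQ
  have key : ∀ j, |(d ᵥ* Q) j| ≤ ∑ i, |d i| * (Q i j - if j = s₀ then δ else 0) := by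
    intro j
    have : (d ᵥ* Q) j = ∑ i, d i * (Q i j - if j = s₀ then δ else 0) := by
      simp only [mul_sub, Finset.sum_sub_distrib, ← Finset.sum_mul, hd, zero_mul, sub_zero]
      rfl
    rw [this]
    refine (Finset.abs_sum_le_sum_abs _ _).trans (Finset.sum_le_sum fun i _ => ?_)
    rw [abs_mul]
    by_cases hi : d i = 0
    · simp [hi]
    · refine mul_le_mul_of_nonneg_left (le_of_eq (abs_of_nonneg ?_)) (abs_nonneg _)
      split_ifs with h
      · rw [h]; linarith [hδ i hi]
      · linarith [nonneg_of_mem_rowStochastic hQ (i := i) (j := j)]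
  refine (Finset.sum_le_sum fun j _ => key j).trans (le_of_eq ?_)
  rw [Finset.sum_comm, Finset.mul_sum]
  refine Finset.sum_congr rfl fun i _ => ?_
  rw [← Finset.mul_sum, Finset.sum_sub_distrib, hsum i, Finset.sum_ite_eq' Finset.univ s₀]
  simp [mul_comm]

theorem sum_abs_vecMul_le {Q : Matrix S S ℝ} (hQ : Q ∈ rowStochastic ℝ S) (d : S → ℝ) :
    ∑ j, |(d ᵥ* Q) j| ≤ ∑ i, |d i| := by
  have hsum : ∀ i, ∑ j, Q i j = 1 := sum_row_of_mem_rowStochastic hQ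
  have key : ∀ j, |(d ᵥ* Q) j| ≤ ∑ i, |d i| * Q i j := fun j => by
    refine (Finset.abs_sum_le_sum_abs _ _).trans (Finset.sum_le_sum fun i _ => ?_)
    rw [abs_mul, abs_of_nonneg (nonneg_of_mem_rowStochastic hQ)]
  refine (Finset.sum_le_sum fun j _ => key j).trans (le_of_eq ?_)
  rw [Finset.sum_comm]
  exact Finset.sum_congr rfl fun i _ => by rw [← Finset.mul_sum, hsum i, mul_one]

theorem pow_pos_of_reflTransGen {P : Matrix S S ℝ} (hP : P ∈ rowStochastic ℝ S) {i s₀ : S}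
    (h : Relation.ReflTransGen (fun a b => 0 < P a b) i s₀) : ∃ N, 0 < (P ^ N) i s₀ := by
  induction h with
  | refl => exact ⟨0, by simp⟩
  | tail _ hbc ih =>
    obtain ⟨N, hN⟩ := ih
    refine ⟨N + 1, ?_⟩
    rw [pow_succ, mul_apply]
    exact Finset.sum_pos' (fun j _ => mul_nonneg
      (nonneg_of_mem_rowStochastic (pow_mem hP N)) (nonneg_of_mem_rowStochastic hP))
      ⟨_, Finset.mem_univ _, mul_pos hN hbc⟩

/-- Waiting at `s₀` lengthens a path, so a single exponent can serve all starting states. -/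
theorem pow_pos_of_le {P : Matrix S S ℝ} (hP : P ∈ rowStochastic ℝ S) {i s₀ : S}
    (hs₀ : 0 < P s₀ s₀) {N M : ℕ} (hNM : N ≤ M) (h : 0 < (P ^ N) i s₀) : 0 < (P ^ M) i s₀ := by
  induction M, hNM using Nat.le_induction with
  | base => exact h
  | succ M _ ih =>
    rw [pow_succ, mul_apply]
    exact Finset.sum_pos' (fun j _ => mul_nonneg
      (nonneg_of_mem_rowStochastic (pow_mem hP M)) (nonneg_of_mem_rowStochastic hP))
      ⟨_, Finset.mem_univ _, mul_pos ih hs₀⟩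

/-- If `P` is reversible with respect to `W`, and if some aperiodic state `s₀` can be reached from
every state of positive weight, then the chain started on the states of positive weight converges
to the normalisation of `W`. -/
theorem tendsto_of_reversible {P : Matrix S S ℝ} (hP : P ∈ rowStochastic ℝ S) {W : S → ℝ}
    (hW : ∀ i, 0 ≤ W i) (hrev : ∀ i j, W i * P i j = W j * P j i) {s₀ : S}
    (hWs₀ : 0 < W s₀) (hs₀ : 0 < P s₀ s₀)
    (hreach : ∀ i, 0 < W i → Relation.ReflTransGen (fun a b => 0 < P a b) i s₀)
    {x : ℕ → S → ℝ} (hx : ∀ t, x (t + 1) = x t ᵥ* P) (hx₁ : ∑ i, x 0 i = 1)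
    (hx₀ : ∀ i, W i = 0 → x 0 i = 0) (j : S) :
    Tendsto (fun t => x t j) atTop (𝓝 (W j / ∑ i, W i)) := by
  have hsum : ∀ i, ∑ j, P i j = 1 := sum_row_of_mem_rowStochastic hP
  have hZ : 0 < ∑ i, W i := Finset.sum_pos' (fun i _ => hW i) ⟨s₀, Finset.mem_univ _, hWs₀⟩
  obtain ⟨N, hN⟩ : ∃ N, ∀ i, 0 < W i → 0 < (P ^ N) i s₀ := by
    have : ∀ i, ∃ N, 0 < W i → 0 < (P ^ N) i s₀ := fun i => by
      by_cases hi : 0 < W i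
      · obtain ⟨N, hN⟩ := pow_pos_of_reflTransGen hP (hreach i hi)
        exact ⟨N, fun _ => hN⟩
      · exact ⟨0, fun h => absurd h hi⟩
    choose f hf using this
    exact ⟨Finset.univ.sup f, fun i hi =>
      pow_pos_of_le hP hs₀ (Finset.le_sup (Finset.mem_univ i)) (hf i hi)⟩
  obtain ⟨δ, hδ, hδN⟩ : ∃ δ : ℝ, 0 < δ ∧ ∀ i, 0 < W i → δ ≤ (P ^ N) i s₀ := by
    have hne : (Finset.univ.filter fun i => 0 < W i).Nonempty := ⟨s₀, by simpa⟩
    obtain ⟨i, hi, hmin⟩ := Finset.exists_min_image _ (fun i => (P ^ N) i s₀) hne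
    exact ⟨_, hN i (by simpa using hi), fun k hk => hmin k (by simpa using hk)⟩
  set w : S → ℝ := fun i => W i / ∑ i, W i with hw
  have hwP : w ᵥ* P = w := by
    ext j
    change ∑ i, w i * P i j = w j
    calc ∑ i, w i * P i j = ∑ i, w j * P j i := Finset.sum_congr rfl fun i _ => by
          simp only [hw, div_mul_eq_mul_div, hrev i j]
      _ = w j := by rw [← Finset.mul_sum, hsum, mul_one]
  have hw₁ : ∑ i, w i = 1 := by rw [hw, ← Finset.sum_div, div_self hZ.ne']
  set d : ℕ → S → ℝ := fun t => x t - w with hd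
  have hdP : ∀ t, d (t + 1) = d t ᵥ* P := fun t => by
    simp only [hd, hx, sub_vecMul, hwP]
  have hdPN : ∀ t n, d (t + n) = d t ᵥ* P ^ n := fun t n => by
    induction n with
    | zero => simp
    | succ n ih => rw [← add_assoc, hdP, ih, vecMul_vecMul, ← pow_succ]
  have hd₁ : ∀ t, ∑ i, d t i = 0 := fun t => by
    induction t with
    | zero => simp [hd, hx₁, hw₁]
    | succ t ih =>
      rw [hdP]
      change ∑ j, ∑ i, d t i * P i j = 0
      rw [Finset.sum_comm]
      simp only [← Finset.mul_sum, hsum, mul_one, ih]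
  -- By reversibility the chain cannot leave the states of positive weight, so the difference stays
  -- supported there.
  have hd₀ : ∀ t i, d t i ≠ 0 → 0 < W i := fun t => by
    induction t with
    | zero =>
      refine fun i hi => (hW i).lt_of_ne' fun h => hi ?_
      simp [hd, hw, h, hx₀ i h]
    | succ t ih =>
      refine fun j hj => (hW j).lt_of_ne' fun h => hj ?_
      rw [hdP]
      refine Finset.sum_eq_zero fun i _ => ?_
      by_cases hi : d t i = 0
      · simp [hi]
      · have := hrev i j
        rw [h, zero_mul, mul_eq_zero] at this
        exact mul_eq_zero_of_right _ (this.resolve_left (ih i hi).ne')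
  set e : ℕ → ℝ := fun t => ∑ i, |d t i| with he
  have he₀ : ∀ t, 0 ≤ e t := fun t => Finset.sum_nonneg fun i _ => abs_nonneg _
  have hanti : Antitone e := antitone_nat_of_succ_le fun t => by
    simp only [he, hdP]
    exact sum_abs_vecMul_le hP _
  have hcontr : ∀ t, e (t + N) ≤ (1 - δ) * e t := fun t => by
    simp only [he, hdPN t N]
    exact sum_abs_vecMul_le_of_minorized (pow_mem hP N) (hd₁ t)
      fun i hi => hδN i (hd₀ t i hi)
  have hlim := tendsto_atTop_ciInf hanti ⟨0, by rintro _ ⟨t, rfl⟩; exact he₀ t⟩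
  set l := ⨅ t, e t
  have hl₀ : 0 ≤ l := ge_of_tendsto' hlim he₀
  have hl : l ≤ (1 - δ) * l := le_of_tendsto_of_tendsto'
    ((tendsto_add_atTop_iff_nat N).2 hlim) (hlim.const_mul _) hcontr
  -- The limit `l` of the decreasing distances satisfies `0 ≤ l ≤ (1 - δ) * l` with `δ > 0`.
  have hl0 : l = 0 := by nlinarith
  rw [hl0] at hlim
  have hdj : Tendsto (fun t => d t j) atTop (𝓝 0) :=
    squeeze_zero_norm (fun t => Finset.single_le_sum (f := fun i => |d t i|)
      (fun i _ => abs_nonneg _) (Finset.mem_univ j)) hlim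
  have := hdj.add_const (w j)
  simpa [hd] using this

end Chain
variable {V C : Type*} [Fintype V] [DecidableEq V] [Fintype C] [DecidableEq C]

/-! ### The active users -/

theorem backoffMeasure_tie {B : ℝ} (hB : 0 < B) {m n : V} (hmn : m ≠ n) :
    backoffMeasure V B {b | b m = b n} = 0 := by
  have : IsProbabilityMeasure ((volume : Measure ℝ)[|Set.Icc 0 B]) :=
    cond_isProbabilityMeasure_of_finite (by simpa using hB) (by simp)
  have hind := (iIndepFun_pi (μ := fun _ : V => (volume : Measure ℝ)[|Set.Icc 0 B])
    (X := fun _ x => x) fun _ => aemeasurable_id).indepFun hmn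
  have hmap : ∀ i : V, (Measure.pi fun _ : V => (volume : Measure ℝ)[|Set.Icc 0 B]).map
      (fun b => b i) = (volume : Measure ℝ)[|Set.Icc 0 B] := fun i =>
    (measurePreserving_eval (fun _ : V => (volume : Measure ℝ)[|Set.Icc 0 B]) i).map_eq
  rw [indepFun_iff_map_prod_eq_prod_map_map (measurable_pi_apply m).aemeasurable
    (measurable_pi_apply n).aemeasurable, hmap, hmap] at hind
  have hd : MeasurableSet {p : ℝ × ℝ | p.1 = p.2} :=
    measurableSet_eq_fun measurable_fst measurable_snd
  change backoffMeasure V B ((fun b => (b m, b n)) ⁻¹' {p : ℝ × ℝ | p.1 = p.2}) = 0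
  rw [← Measure.map_apply (by fun_prop) hd, backoffMeasure, hind, Measure.measure_prod_null hd]
  refine Eventually.of_forall fun x => cond_absolutelyContinuous ?_
  exact measure_mono_null (t := {x}) (fun y hy => (show x = y from hy).symm) (by simp)

/-- The event contains a box of positive measure: `b n` in the lowest third of the interval, all
other times in the upper half. -/
theorem backoffMeasure_first_pos {B : ℝ} (hB : 0 < B) (n : V) :
    0 < backoffMeasure V B {b | ∀ m, m ≠ n → b n < b m} := by
  have hsub : (Set.univ.pi fun m => if m = n then Set.Icc 0 (B / 3) else Set.Icc (B / 2) B) ⊆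
      {b : V → ℝ | ∀ m, m ≠ n → b n < b m} := by
    intro b hb m hm
    have h₁ := hb n trivial
    have h₂ := hb m trivial
    simp only [if_true, hm, if_false] at h₁ h₂
    linarith [h₁.2, h₂.1]
  refine lt_of_lt_of_le ?_ (measure_mono hsub)
  rw [backoffMeasure, Measure.pi_pi, CanonicallyOrderedAdd.prod_pos]
  intro m _
  rw [cond_apply measurableSet_Icc]
  refine ENNReal.mul_pos (by simp) ?_
  split_ifs
  · rw [Set.Icc_inter_Icc]
    simp [hB]
  · rw [Set.Icc_inter_Icc]
    simp [hB]

theorem not_adj_of_activeLaw_ne_zero (G : SimpleGraph V) {B : ℝ} (hB : 0 < B) {S : Finset V}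
    (hS : activeLaw G hB S ≠ 0) {m n : V} (hm : m ∈ S) (hn : n ∈ S) : ¬ G.Adj m n := by
  intro hadj
  refine hS (measure_mono_null ?_ (backoffMeasure_tie hB hadj.ne))
  intro b hb
  rw [Set.mem_ofPred_eq, activeSet_eq_iff] at hb
  by_contra h
  rcases lt_or_gt_of_ne h with h | h
  · exact (hb n).1 hn m hadj.symm h hm
  · exact (hb m).1 hm n hadj h hn

/-- A user whose backoff time expires first is active, and this has positive probability. -/
theorem exists_activeLaw_ne_zero (G : SimpleGraph V) {B : ℝ} (hB : 0 < B) (n : V) :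
    ∃ S, n ∈ S ∧ activeLaw G hB S ≠ 0 := by
  by_contra! h
  refine (backoffMeasure_first_pos hB n).ne' (measure_mono_null
    (t := ⋃ S ∈ {S : Finset V | n ∈ S}, {b : V → ℝ | activeSet G b = S}) ?_ ?_)
  · intro b hb
    simp only [Set.mem_iUnion]
    refine ⟨activeSet G b, ?_, rfl⟩
    rw [Set.mem_ofPred_eq, (activeSet_eq_iff G b _).1 rfl n]
    intro m hm hlt
    exact absurd (hb m hm.ne') hlt.not_gt
  · exact (measure_biUnion_null_iff (Set.to_countable _)).2 fun S hS => h S hS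

/-! ### The product of the rates -/

section Profile

variable (G : SimpleGraph V) [DecidableRel G.Adj] (u : V → C → ℝ)

/-- The exponential of the cooperative utility. -/
def coopValue (σ : Profile V C) (n : V) (k : C) (p : ℝ) : ℝ :=
  u n k * p * successProb G σ n k * (1 - p) ^ (neighborsOn G σ n k).card

/-- The factor by which user `i` reduces the rate of user `n`. -/
def pairFactor (σ : Profile V C) (n i : V) : ℝ :=
  if G.Adj n i ∧ (σ i).1 = (σ n).1 then 1 - (σ i).2 else 1

theorem successProb_eq_prod_pairFactor (σ : Profile V C) (n : V) :
    successProb G σ n (σ n).1 = ∏ i, pairFactor G σ n i := by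
  simp only [successProb, pairFactor, SimpleGraph.neighborFinset_eq_filter, Finset.prod_filter]
  refine Finset.prod_congr rfl fun i _ => ?_
  by_cases h : G.Adj n i <;> by_cases h' : (σ i).1 = (σ n).1 <;> simp [h, h']

theorem prod_pairFactor_eq_pow (σ : Profile V C) (i : V) :
    ∏ n, pairFactor G σ n i = (1 - (σ i).2) ^ (neighborsOn G σ i (σ i).1).card := by
  rw [← Finset.prod_const, neighborsOn, Finset.prod_filter, SimpleGraph.neighborFinset_eq_filter,
    Finset.prod_filter]
  refine Finset.prod_congr rfl fun n _ => ?_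
  by_cases h : G.Adj n i <;> by_cases h' : (σ i).1 = (σ n).1 <;>
    simp [pairFactor, h, h', G.adj_comm i n, eq_comm (a := (σ n).1)]

/-- The part of the product of the rates that does not involve the users in `S`. -/
def restRate (S : Finset V) (σ : Profile V C) : ℝ :=
  ∏ n ∈ Sᶜ, ((σ n).2 * u n (σ n).1 * ∏ i ∈ Sᶜ, pairFactor G σ n i)

theorem restRate_congr {S : Finset V} {σ τ : Profile V C} (h : ∀ n, n ∉ S → σ n = τ n) :
    restRate G u S σ = restRate G u S τ := by
  refine Finset.prod_congr rfl fun n hn => ?_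
  rw [h n (by simpa using hn)]
  congr 1
  refine Finset.prod_congr rfl fun i hi => ?_
  rw [pairFactor, pairFactor, h n (by simpa using hn), h i (by simpa using hi)]

/-- Pairs inside `S` contribute 1 by independence. For `i ∈ S`, what `i` suffers is its success
probability, and what it inflicts is `(1 - p_i)` to the number of its co-channel neighbours;
together these make up `coopValue`. -/
theorem prod_rate_eq_mul_restRate {S : Finset V} (hS : ∀ m ∈ S, ∀ n ∈ S, ¬ G.Adj m n)
    (σ : Profile V C) :
    ∏ n, rate G u σ n =
      (∏ n ∈ S, coopValue G u σ n (σ n).1 (σ n).2) * restRate G u S σ := by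
  have hcol : ∀ i ∈ S, ∏ n ∈ Sᶜ, pairFactor G σ n i =
      (1 - (σ i).2) ^ (neighborsOn G σ i (σ i).1).card := fun i hi => by
    rw [← prod_pairFactor_eq_pow, ← Finset.prod_compl_mul_prod S,
      Finset.prod_eq_one (s := S) fun n hn => ?_, mul_one]
    simp [pairFactor, hS n hn i hi]
  have hrest : ∏ n ∈ Sᶜ, rate G u σ n =
      (∏ i ∈ S, (1 - (σ i).2) ^ (neighborsOn G σ i (σ i).1).card) * restRate G u S σ := by
    rw [← Finset.prod_congr rfl hcol, Finset.prod_comm, restRate, ← Finset.prod_mul_distrib]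
    refine Finset.prod_congr rfl fun n _ => ?_
    rw [rate, successProb_eq_prod_pairFactor, ← Finset.prod_mul_prod_compl S]
    ring
  rw [← Finset.prod_mul_prod_compl S, hrest, ← mul_assoc, ← Finset.prod_mul_distrib]
  congr 1
  refine Finset.prod_congr rfl fun n _ => ?_
  rw [rate, coopValue]
  ring

/-- Collecting the pair factors by the interfering user decouples the attempt probabilities once the
channels are fixed. -/
theorem prod_rate_eq (σ : Profile V C) :
    ∏ n, rate G u σ n =
      ∏ n, ((σ n).2 * (1 - (σ n).2) ^ (neighborsOn G σ n (σ n).1).card * u n (σ n).1) := by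
  simp only [← prod_pairFactor_eq_pow, rate, successProb_eq_prod_pairFactor,
    Finset.prod_mul_distrib]
  rw [Finset.prod_comm]
  ring

theorem neighborsOn_congr {σ τ : Profile V C} {n : V} (h : ∀ i, G.Adj n i → σ i = τ i) (k : C) :
    neighborsOn G σ n k = neighborsOn G τ n k :=
  Finset.filter_congr fun i hi => by rw [h i (by simpa using hi)]

theorem successProb_congr {σ τ : Profile V C} {n : V} (h : ∀ i, G.Adj n i → σ i = τ i) (k : C) :
    successProb G σ n k = successProb G τ n k :=
  Finset.prod_congr rfl fun i hi => by rw [h i (by simpa using hi)]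

theorem coopValue_congr {σ τ : Profile V C} {n : V} (h : ∀ i, G.Adj n i → σ i = τ i) (k : C)
    (p : ℝ) : coopValue G u σ n k p = coopValue G u τ n k p := by
  rw [coopValue, coopValue, successProb_congr G h, neighborsOn_congr G h]

theorem successProb_nonneg {σ : Profile V C} (hσ : σ ∈ feasible V C) (n : V) (k : C) :
    0 ≤ successProb G σ n k :=
  Finset.prod_nonneg fun i _ => pow_nonneg (by linarith [(hσ i).2]) _

variable {u} in
theorem coopValue_nonneg (hu : ∀ n k, 0 ≤ u n k) {σ : Profile V C} (hσ : σ ∈ feasible V C)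
    (n : V) (k : C) {p : ℝ} (hp : 0 ≤ p) (hp₁ : p ≤ 1) : 0 ≤ coopValue G u σ n k p :=
  mul_nonneg (mul_nonneg (mul_nonneg (hu n k) hp) (successProb_nonneg G hσ n k))
    (pow_nonneg (by linarith) _)

variable {u} in
theorem rate_nonneg (hu : ∀ n k, 0 ≤ u n k) {σ : Profile V C} (hσ : σ ∈ feasible V C) (n : V) :
    0 ≤ rate G u σ n :=
  mul_nonneg (mul_nonneg (hσ n).1 (hu n _)) (successProb_nonneg G hσ n _)

variable {u} in
-- The extended logarithm turns products and powers into sums and multiples even at 0, so infinite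
-- utilities need no separate case.
theorem exp_mul_coopUtility (hu : ∀ n k, 0 ≤ u n k) {σ : Profile V C} (hσ : σ ∈ feasible V C)
    (n : V) (k : C) {p : ℝ} (hp : 0 ≤ p) (hp₁ : p ≤ 1) (β : ℝ) :
    EReal.exp ((β : EReal) * coopUtility G u σ n k p) =
      ENNReal.ofReal (coopValue G u σ n k p) ^ β := by
  have h₁ : 0 ≤ u n k * p := mul_nonneg (hu n k) hp
  have h₂ := successProb_nonneg G hσ n k
  rw [coopUtility, logInterference, elog, elog, sub_eq_add_neg, sub_eq_add_neg, neg_neg, one_div,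
    ENNReal.log_inv, EReal.neg_mul, neg_neg, ← ENNReal.log_mul_add, mul_comm _ ((Finset.card _ : ℕ) : EReal),
    ← ENNReal.log_pow, ← ENNReal.log_mul_add, ← ENNReal.rpow_eq_exp_mul_log,
    ← ENNReal.ofReal_mul h₁, ← ENNReal.ofReal_pow (by linarith),
    ← ENNReal.ofReal_mul (mul_nonneg h₁ h₂), coopValue]

end Profile

/-! ### The transition law -/

section State

variable (G : SimpleGraph V) [DecidableRel G.Adj] (u : V → C → ℝ)

theorem toStrategy_nonneg (n : V) (a : Action C G n) : 0 ≤ (toStrategy G n a).2 := by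
  simp only [toStrategy]
  positivity

theorem toStrategy_pos (n : V) (a : Action C G n) : 0 < (toStrategy G n a).2 := by
  simp only [toStrategy]
  positivity

theorem toStrategy_le_one (n : V) (a : Action C G n) : (toStrategy G n a).2 ≤ 1 := by
  simp only [toStrategy]
  rw [div_le_one (by positivity)]
  linarith [(a.2 : ℕ).cast_nonneg (α := ℝ)]

theorem toStrategy_lt_one {n : V} {a : Action C G n} (h : (a.2 : ℕ) ≠ 0) :
    (toStrategy G n a).2 < 1 := by
  simp only [toStrategy]
  rw [div_lt_one (by positivity)]
  have : (0 : ℝ) < (a.2 : ℕ) := by exact_mod_cast Nat.pos_of_ne_zero h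
  linarith

theorem toProfile_mem_feasible (s : State C G) : toProfile G s ∈ feasible V C :=
  fun n => ⟨toStrategy_nonneg G n _, toStrategy_le_one G n _⟩

/-- The exponential of the cooperative utility of an action. -/
def actionValue (s : State C G) (n : V) (a : Action C G n) : ℝ :=
  coopValue G u (toProfile G s) n (toStrategy G n a).1 (toStrategy G n a).2

/-- The product of the rates of all users. -/
def prodRate (s : State C G) : ℝ := ∏ n, rate G u (toProfile G s) n

/-- The unnormalised Gibbs weight of a state. -/
def gibbs (β : ℝ) (s : State C G) : ℝ≥0∞ := ENNReal.ofReal (prodRate G u s) ^ β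

/-- The transition law of the algorithm. -/
def transition {B : ℝ} (hB : 0 < B) (β : ℝ) (s : State C G) : PMF (State C G) :=
  (activeLaw G hB).bind (update G u β s)

variable {u} (hu : ∀ n k, 0 ≤ u n k)
include hu

theorem actionValue_nonneg (s : State C G) (n : V) (a : Action C G n) :
    0 ≤ actionValue G u s n a :=
  coopValue_nonneg G hu (toProfile_mem_feasible G s) n _ (toStrategy_nonneg G n a)
    (toStrategy_le_one G n a)

theorem prodRate_nonneg (s : State C G) : 0 ≤ prodRate G u s :=
  Finset.prod_nonneg fun n _ => rate_nonneg G hu (toProfile_mem_feasible G s) n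

theorem weight_eq (β : ℝ) (s : State C G) (n : V) (a : Action C G n) :
    weight G u β s n a = ENNReal.ofReal (actionValue G u s n a) ^ β :=
  exp_mul_coopUtility G hu (toProfile_mem_feasible G s) n _ (toStrategy_nonneg G n a)
    (toStrategy_le_one G n a) β

omit hu in
theorem actionValue_congr {s t : State C G} {n : V} (h : ∀ i, G.Adj n i → s i = t i)
    (a : Action C G n) : actionValue G u s n a = actionValue G u t n a :=
  coopValue_congr G u (fun i hi => by rw [toProfile, toProfile, h i hi]) _ _

omit hu in
theorem prodRate_eq_mul_restRate {S : Finset V} (hS : ∀ m ∈ S, ∀ n ∈ S, ¬ G.Adj m n)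
    (s : State C G) :
    prodRate G u s =
      (∏ n ∈ S, actionValue G u s n (s n)) * restRate G u S (toProfile G s) :=
  prod_rate_eq_mul_restRate G u hS (toProfile G s)

theorem tsum_weight_ne_top {β : ℝ} (hβ : 0 < β) (s : State C G) (n : V) :
    ∑' a, weight G u β s n a ≠ ∞ := by
  rw [tsum_fintype]
  refine ENNReal.sum_ne_top.2 fun a _ => ?_
  rw [weight_eq G hu]
  exact ENNReal.rpow_ne_top_of_nonneg hβ.le ENNReal.ofReal_ne_top

theorem noisyBR_ne_zero {β : ℝ} (hβ : 0 < β) {s : State C G} {n : V} {a : Action C G n}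
    (h : 0 < actionValue G u s n a) : noisyBR G u β s n a ≠ 0 := by
  have hw : weight G u β s n a ≠ 0 := by
    rw [weight_eq G hu]
    exact (ENNReal.rpow_pos (ENNReal.ofReal_pos.2 h) ENNReal.ofReal_ne_top).ne'
  rw [noisyBR, dif_pos ⟨fun h0 => hw (ENNReal.tsum_eq_zero.1 h0 a), tsum_weight_ne_top G hu hβ s n⟩,
    PMF.normalize_apply]
  exact mul_ne_zero hw (ENNReal.inv_ne_zero.2 (tsum_weight_ne_top G hu hβ s n))

/-- Equal neighbourhoods give equal weights and normalisers, so both sides are w(s n) w(t n) / Z. If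
Z = 0, both vanish because the weights do. -/
theorem weight_mul_noisyBR_comm {β : ℝ} (hβ : 0 < β) {s t : State C G} {n : V}
    (h : ∀ i, G.Adj n i → s i = t i) :
    weight G u β s n (s n) * noisyBR G u β s n (t n) =
      weight G u β t n (t n) * noisyBR G u β t n (s n) := by
  have hw : weight G u β s n = weight G u β t n := by
    ext a
    rw [weight_eq G hu, weight_eq G hu, actionValue_congr G h]
  by_cases hZ : ∑' a, weight G u β t n a = 0
  · rw [hw, ENNReal.tsum_eq_zero.1 hZ, ENNReal.tsum_eq_zero.1 hZ, zero_mul, zero_mul]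
  · have hZt := tsum_weight_ne_top G hu hβ t n
    rw [noisyBR, noisyBR, dif_pos (by rw [hw]; exact ⟨hZ, hZt⟩), dif_pos ⟨hZ, hZt⟩,
      PMF.normalize_apply, PMF.normalize_apply, hw]
    ring

omit hu in
theorem update_apply (β : ℝ) (s : State C G) (S : Finset V) (t : State C G) :
    update G u β s S t = ∏ n, (if n ∈ S then noisyBR G u β s n else PMF.pure (s n)) (t n) := rfl

omit hu in
theorem update_apply_of_eq {β : ℝ} {s t : State C G} {S : Finset V} (h : ∀ n, n ∉ S → s n = t n) :
    update G u β s S t = ∏ n ∈ S, noisyBR G u β s n (t n) := by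
  rw [update_apply, ← Finset.prod_subset (Finset.subset_univ S)]
  · exact Finset.prod_congr rfl fun n hn => by rw [if_pos hn]
  · intro n _ hn
    simp [hn, h n hn]

omit hu in
theorem update_apply_of_ne {β : ℝ} {s t : State C G} {S : Finset V} {n : V} (hn : n ∉ S)
    (h : s n ≠ t n) : update G u β s S t = 0 := by
  rw [update_apply]
  refine Finset.prod_eq_zero (Finset.mem_univ n) ?_
  simp [hn, h.symm]

theorem gibbs_eq {β : ℝ} (hβ : 0 < β) {S : Finset V} (hS : ∀ m ∈ S, ∀ n ∈ S, ¬ G.Adj m n)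
    (s : State C G) :
    gibbs G u β s = (∏ n ∈ S, weight G u β s n (s n)) *
      ENNReal.ofReal (restRate G u S (toProfile G s)) ^ β := by
  rw [gibbs, prodRate_eq_mul_restRate G hS, ENNReal.ofReal_mul
    (Finset.prod_nonneg fun n _ => actionValue_nonneg G hu s n _), ENNReal.mul_rpow_of_nonneg _ _
    hβ.le, ENNReal.ofReal_prod_of_nonneg fun n _ => actionValue_nonneg G hu s n _,
    ← ENNReal.prod_rpow_of_nonneg hβ.le]
  simp only [weight_eq G hu]

theorem gibbs_mul_update_comm {β : ℝ} (hβ : 0 < β) {S : Finset V}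
    (hS : ∀ m ∈ S, ∀ n ∈ S, ¬ G.Adj m n) (s t : State C G) :
    gibbs G u β s * update G u β s S t = gibbs G u β t * update G u β t S s := by
  by_cases h : ∀ n, n ∉ S → s n = t n
  · rw [update_apply_of_eq G h, update_apply_of_eq G fun n hn => (h n hn).symm,
      gibbs_eq G hu hβ hS s, gibbs_eq G hu hβ hS t,
      restRate_congr G u (τ := toProfile G t) fun n hn => by rw [toProfile, toProfile, h n hn],
      mul_right_comm, mul_right_comm (∏ n ∈ S, weight G u β t n (t n)),
      ← Finset.prod_mul_distrib, ← Finset.prod_mul_distrib]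
    congr 1
    exact Finset.prod_congr rfl fun n hn =>
      weight_mul_noisyBR_comm G hu hβ fun i hi => h i fun hi' => hS n hn i hi' hi
  · push Not at h
    obtain ⟨n, hn, hne⟩ := h
    rw [update_apply_of_ne G hn hne, update_apply_of_ne G hn hne.symm, mul_zero, mul_zero]

/-- Detailed balance. -/
theorem gibbs_mul_transition_comm {B : ℝ} (hB : 0 < B) {β : ℝ} (hβ : 0 < β) (s t : State C G) :
    gibbs G u β s * transition G u hB β s t = gibbs G u β t * transition G u hB β t s := by
  rw [transition, transition, PMF.bind_apply, PMF.bind_apply, ← ENNReal.tsum_mul_left,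
    ← ENNReal.tsum_mul_left]
  refine tsum_congr fun S => ?_
  by_cases hS : activeLaw G hB S = 0
  · simp [hS]
  · rw [mul_left_comm, mul_left_comm (gibbs G u β t), gibbs_mul_update_comm G hu hβ fun m hm n hn =>
      not_adj_of_activeLaw_ne_zero G hB hS hm hn]

theorem actionValue_self_pos {s : State C G} (hs : 0 < prodRate G u s) (n : V) :
    0 < actionValue G u s n (s n) := by
  refine (actionValue_nonneg G hu s n _).lt_of_ne' fun h => hs.ne' ?_
  rw [prodRate_eq_mul_restRate G (S := {n}) (by simp), Finset.prod_singleton, h, zero_mul]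

theorem prodRate_update_pos {s : State C G} (hs : 0 < prodRate G u s) {n : V} {a : Action C G n}
    (ha : 0 < actionValue G u s n a) : 0 < prodRate G u (Function.update s n a) := by
  have hrest : 0 < restRate G u {n} (toProfile G s) := by
    have := actionValue_self_pos G hu hs n
    rw [prodRate_eq_mul_restRate G (S := {n}) (by simp), Finset.prod_singleton] at hs
    exact pos_of_mul_pos_right hs this.le
  rw [prodRate_eq_mul_restRate G (S := {n}) (by simp), Finset.prod_singleton,
    Function.update_self, restRate_congr G u (τ := toProfile G s)]
  · refine mul_pos (lt_of_lt_of_eq ha (actionValue_congr G (fun i hi => ?_) a)) hrest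
    rw [Function.update_of_ne hi.ne']
  · intro m hm
    rw [toProfile, toProfile, Function.update_of_ne (by simpa using hm)]

/-- The other users active together with `n` may redraw their current actions, so a change of `n`
alone has positive probability. -/
theorem transition_update_ne_zero {B : ℝ} (hB : 0 < B) {β : ℝ} (hβ : 0 < β) {s : State C G}
    (hs : 0 < prodRate G u s) {n : V} {a : Action C G n} (ha : 0 < actionValue G u s n a) :
    transition G u hB β s (Function.update s n a) ≠ 0 := by
  obtain ⟨S, hn, hS⟩ := exists_activeLaw_ne_zero G hB n
  rw [transition, PMF.bind_apply]
  refine fun h => mul_ne_zero hS ?_ (ENNReal.tsum_eq_zero.1 h S)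
  rw [update_apply_of_eq G fun m hm => ?_]
  · refine Finset.prod_ne_zero_iff.2 fun m _ => noisyBR_ne_zero G hu hβ ?_
    by_cases hmn : m = n
    · subst hmn
      rwa [Function.update_self]
    · rw [Function.update_of_ne hmn]
      exact actionValue_self_pos G hu hs m
  · rw [Function.update_of_ne]
    rintro rfl
    exact hm hn

theorem transition_self_ne_zero [Nonempty V] {B : ℝ} (hB : 0 < B) {β : ℝ} (hβ : 0 < β)
    {s : State C G} (hs : 0 < prodRate G u s) : transition G u hB β s s ≠ 0 := by
  obtain ⟨n⟩ := ‹Nonempty V›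
  simpa using transition_update_ne_zero G hu hB hβ hs (actionValue_self_pos G hu hs n)

/-! ### Reachability -/

/-- The users move from `s` to `t` one at a time; `T` is the set of those already moved. -/
theorem reflTransGen_of_actionValue_pos {B : ℝ} (hB : 0 < B) {β : ℝ} (hβ : 0 < β)
    {s t : State C G} (hs : 0 < prodRate G u s)
    (h : ∀ (T : Finset V) (n : V), 0 < prodRate G u (T.piecewise t s) →
      0 < actionValue G u (T.piecewise t s) n (t n)) :
    Relation.ReflTransGen (fun a b => transition G u hB β a b ≠ 0) s t ∧ 0 < prodRate G u t := by
  suffices H : ∀ T : Finset V,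
      Relation.ReflTransGen (fun a b => transition G u hB β a b ≠ 0) s (T.piecewise t s) ∧
        0 < prodRate G u (T.piecewise t s) by
    simpa using H Finset.univ
  intro T
  induction T using Finset.induction with
  | empty => simpa using ⟨Relation.ReflTransGen.refl, hs⟩
  | insert n T _ ih =>
    rw [Finset.piecewise_insert]
    have := h T n ih.2
    exact ⟨ih.1.tail (transition_update_ne_zero G hu hB hβ ih.2 this),
      prodRate_update_pos G hu ih.2 this⟩

omit hu in
-- The smallest attempt probability equals 1 only for an isolated user, and then the exponent is 0.
theorem pow_card_neighborsOn_pos (σ : Profile V C) (n : V) (k k' : C) :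
    0 < (1 - (toStrategy G n (k', Fin.last (G.degree n))).2) ^ (neighborsOn G σ n k).card := by
  by_cases hd : G.degree n = 0
  · have : (neighborsOn G σ n k).card = 0 :=
      Nat.le_zero.1 ((Finset.card_filter_le _ _).trans (by simp [hd]))
    simp [this]
  · exact pow_pos (sub_pos.2 (toStrategy_lt_one G (by simpa using hd))) _

omit hu in
theorem degree_ne_zero_of_adj {n i : V} (h : G.Adj n i) : G.degree i ≠ 0 := by
  have : n ∈ G.neighborFinset i := by simpa using h.symm
  exact Finset.card_ne_zero_of_mem this

/-- The state with channels `k` and smallest attempt probabilities is reached from every state of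
positive weight, provided that the channels in `k` have positive rates. -/
theorem reflTransGen_last {B : ℝ} (hB : 0 < B) {β : ℝ} (hβ : 0 < β) {k : V → C}
    (hk : ∀ n, 0 < u n (k n)) {s : State C G} (hs : 0 < prodRate G u s) :
    Relation.ReflTransGen (fun a b => transition G u hB β a b ≠ 0) s
      (fun n => (k n, Fin.last (G.degree n))) := by
  -- First the probabilities are lowered on the current channels, where success already has positive
  -- probability. Afterwards every channel has positive success probability, so the channels can be
  -- switched.
  obtain ⟨h₁, hpos⟩ := reflTransGen_of_actionValue_pos G hu hB hβ
    (t := fun n => ((s n).1, Fin.last (G.degree n))) hs fun T n hT => by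
      set r := T.piecewise (fun n => ((s n).1, Fin.last (G.degree n))) s with hr
      have hrn : (r n).1 = (s n).1 := by
        by_cases hn : n ∈ T <;> simp [hr, hn]
      have hv := actionValue_self_pos G hu hT n
      have hp := toStrategy_pos G n (r n)
      simp only [actionValue, coopValue] at hv ⊢
      have h1 : (toStrategy G n (r n)).1 = (s n).1 := hrn
      rw [h1] at hv
      refine mul_pos ?_ (pow_card_neighborsOn_pos G _ n _ _)
      have hw := pos_of_mul_pos_left hv (pow_nonneg (sub_nonneg.2 (toStrategy_le_one G n _)) _)
      have hs0 := successProb_nonneg G (toProfile_mem_feasible G r) n (s n).1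
      have hup := pos_of_mul_pos_left hw hs0
      exact mul_pos (mul_pos (pos_of_mul_pos_left hup hp.le) (toStrategy_pos G n _))
        (pos_of_mul_pos_right hw hup.le)
  refine h₁.trans (reflTransGen_of_actionValue_pos G hu hB hβ hpos fun T n _ => ?_).1
  set r := T.piecewise (fun n => (k n, Fin.last (G.degree n)))
    (fun n => ((s n).1, Fin.last (G.degree n))) with hr
  have hrn : ∀ i, (r i).2 = Fin.last (G.degree i) := fun i => by
    by_cases hi : i ∈ T <;> simp [hr, hi]
  refine mul_pos (mul_pos (mul_pos (hk n) (toStrategy_pos G n _)) ?_)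
    (pow_card_neighborsOn_pos G _ n _ _)
  refine Finset.prod_pos fun i hi => pow_pos (sub_pos.2 (toStrategy_lt_one G ?_)) _
  rw [hrn]
  simpa using degree_ne_zero_of_adj G (by simpa using hi)

omit hu in
theorem prodRate_last_pos {k : V → C} (hk : ∀ n, 0 < u n (k n)) :
    0 < prodRate G u (fun n => (k n, Fin.last (G.degree n))) := by
  refine Finset.prod_pos fun n _ => mul_pos (mul_pos (toStrategy_pos G n _) (hk n)) ?_
  refine Finset.prod_pos fun i hi => pow_pos (sub_pos.2 (toStrategy_lt_one G ?_)) _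
  simpa using degree_ne_zero_of_adj G (by simpa using hi)

omit hu in
theorem prodRate_initState_pos {k₀ : V → C} (hk : ∀ n, 0 < u n (k₀ n)) :
    0 < prodRate G u (initState G k₀) := by
  refine Finset.prod_pos fun n _ => mul_pos (mul_pos (toStrategy_pos G n _) (hk n)) ?_
  refine Finset.prod_pos fun i hi => ?_
  split_ifs with h
  · refine pow_pos (sub_pos.2 (toStrategy_lt_one G ?_)) _
    -- A neighbour on the same channel counts `n` among its own co-channel neighbours, so it starts
    -- with probability at most 1/2.
    refine Finset.card_ne_zero_of_mem (a := n) (Finset.mem_filter.2 ⟨?_, h.symm⟩)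
    rw [SimpleGraph.mem_neighborFinset] at hi ⊢
    exact hi.symm
  · simp

end State

/-! ### Proportionally fair states -/

theorem succ_mul_pow_le {y : ℝ} (hy : 0 ≤ y) (c : ℕ) :
    ((c : ℝ) + 1) * y ^ c ≤ 1 + c * y ^ (c + 1) := by
  induction c with
  | zero => simp
  | succ c ih =>
    -- Adding this to `y` times the induction hypothesis gives the claim.
    have h : 0 ≤ (1 - y) * (1 - y ^ (c + 1)) := by
      rcases le_total y 1 with h | h
      · exact mul_nonneg (sub_nonneg.2 h) (sub_nonneg.2 (pow_le_one₀ hy h))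
      · exact mul_nonneg_of_nonpos_of_nonpos (sub_nonpos.2 h) (sub_nonpos.2 (one_le_pow₀ h))
    have := mul_le_mul_of_nonneg_left ih hy
    push_cast
    ring_nf at this h ⊢
    linarith

/-- The function `p (1 - p) ^ c` is maximal at `p = 1 / (c + 1)`. -/
theorem mul_one_sub_pow_le {p : ℝ} (hp₁ : p ≤ 1) (c : ℕ) :
    p * (1 - p) ^ c ≤ 1 / ((c : ℝ) + 1) * (1 - 1 / ((c : ℝ) + 1)) ^ c := by
  rcases Nat.eq_zero_or_pos c with rfl | hc
  · simpa using hp₁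
  have hc' : (0 : ℝ) < c := by exact_mod_cast hc
  -- `y` is the ratio of `1 - p` to its optimal value `c / (c + 1)`.
  obtain ⟨y, hy⟩ : ∃ y, y = (1 - p) * (c + 1) / c := ⟨_, rfl⟩
  have hy0 : 0 ≤ y := by
    rw [hy]
    exact div_nonneg (mul_nonneg (by linarith) (by linarith)) hc'.le
  have hp : 1 - p = y * (c / (c + 1)) := by rw [hy]; field_simp
  have hq : 1 - 1 / ((c : ℝ) + 1) = c / (c + 1) := by field_simp; ring
  rw [hq, hp, mul_pow, ← mul_assoc]
  refine mul_le_mul_of_nonneg_right ?_ (by positivity)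
  have hp' : p = (c + 1 - c * y) / (c + 1) := by
    have : p = 1 - y * (c / (c + 1)) := by linarith
    rw [this]; field_simp
  rw [hp', div_mul_eq_mul_div]
  refine div_le_div_of_nonneg_right ?_ (by positivity)
  have := succ_mul_pow_le hy0 c
  rw [pow_succ] at this
  linarith

theorem sum_elog {ι : Type*} (s : Finset ι) {f : ι → ℝ} (hf : ∀ i, 0 ≤ f i) :
    ∑ i ∈ s, elog (f i) = elog (∏ i ∈ s, f i) := by
  classical
  induction s using Finset.induction with
  | empty => simp [elog]
  | insert i s hi ih =>
    rw [Finset.sum_insert hi, Finset.prod_insert hi, ih, elog, elog, elog,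
      ENNReal.ofReal_mul (hf i), ENNReal.log_mul_add]

section Optima

variable (G : SimpleGraph V) [DecidableRel G.Adj] {u : V → C → ℝ}

/-- Keep the channels and optimise each decoupled factor. The co-channel counts depend on the
channels only and are at most the degree, so the optimum lies on the grid. -/
theorem exists_prod_rate_le_prodRate (hu : ∀ n k, 0 ≤ u n k) {σ : Profile V C}
    (hσ : σ ∈ feasible V C) : ∃ s : State C G, ∏ n, rate G u σ n ≤ prodRate G u s := by
  refine ⟨fun n => ((σ n).1, ⟨(neighborsOn G σ n (σ n).1).card,
    Nat.lt_succ_of_le (Finset.card_filter_le _ _)⟩), ?_⟩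
  rw [prodRate, prod_rate_eq, prod_rate_eq]
  refine Finset.prod_le_prod (fun n _ => mul_nonneg (mul_nonneg (hσ n).1
    (pow_nonneg (sub_nonneg.2 (hσ n).2) _)) (hu n _)) fun n _ => ?_
  exact mul_le_mul_of_nonneg_right (mul_one_sub_pow_le (hσ n).2 _) (hu n _)

theorem toProfile_mem_propFairOptima (hu : ∀ n k, 0 ≤ u n k) {s : State C G}
    (hs : ∀ t, prodRate G u t ≤ prodRate G u s) : toProfile G s ∈ propFairOptima G u := by
  refine ⟨toProfile_mem_feasible G s, fun σ hσ => ?_⟩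
  obtain ⟨t, ht⟩ := exists_prod_rate_le_prodRate G hu hσ
  change sumLogRate G u σ ≤ sumLogRate G u (toProfile G s)
  rw [sumLogRate, sumLogRate, sum_elog _ (rate_nonneg G hu hσ),
    sum_elog _ (rate_nonneg G hu (toProfile_mem_feasible G s))]
  exact ENNReal.log_monotone (ENNReal.ofReal_le_ofReal (ht.trans (hs t)))

end Optima

/-! ### Concentration of Gibbs measures -/

/-- Outside `A` the ratios `f i / f i₀` are below 1, so their powers tend to 0 and bound the mass
there. -/
theorem eventually_one_sub_le_sum_rpow_div {S : Type*} [Fintype S] {f : S → ℝ}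
    (hf : ∀ i, 0 ≤ f i) {i₀ : S} (hi₀ : 0 < f i₀) (A : Finset S) (hA : ∀ i ∉ A, f i < f i₀)
    {ε : ℝ} (hε : 0 < ε) :
    ∀ᶠ β : ℝ in atTop, 1 - ε ≤ ∑ i ∈ A, f i ^ β / ∑ j, f j ^ β := by
  classical
  have hlim : Tendsto (fun β : ℝ => ∑ i ∈ Aᶜ, (f i / f i₀) ^ β) atTop (𝓝 0) := by
    rw [← Finset.sum_const_zero (s := Aᶜ)]
    refine tendsto_finsetSum _ fun i hi => tendsto_rpow_atTop_of_base_lt_one _ ?_ ?_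
    · linarith [div_nonneg (hf i) hi₀.le]
    · exact (div_lt_one hi₀).2 (hA i (by simpa using hi))
  filter_upwards [hlim.eventually (gt_mem_nhds hε)] with β hβ
  have hle : f i₀ ^ β ≤ ∑ j, f j ^ β := Finset.single_le_sum
    (f := fun j => f j ^ β) (fun j _ => Real.rpow_nonneg (hf j) β) (Finset.mem_univ i₀)
  have hpos : 0 < f i₀ ^ β := Real.rpow_pos_of_pos hi₀ β
  have hsplit : ∑ i ∈ A, f i ^ β / ∑ j, f j ^ β + ∑ i ∈ Aᶜ, f i ^ β / ∑ j, f j ^ β = 1 := by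
    rw [Finset.sum_add_sum_compl, ← Finset.sum_div, div_self (hpos.trans_le hle).ne']
  have hcompl : ∑ i ∈ Aᶜ, f i ^ β / ∑ j, f j ^ β ≤ ∑ i ∈ Aᶜ, (f i / f i₀) ^ β :=
    Finset.sum_le_sum fun i _ => by
      rw [Real.div_rpow (hf i) hi₀.le]
      exact div_le_div_of_nonneg_left (Real.rpow_nonneg (hf i) β) hpos hle
  linarith

/-! ### The limit law -/

section Limit

variable (G : SimpleGraph V) [DecidableRel G.Adj] {u : V → C → ℝ} {B : ℝ} (hB : 0 < B)

open Classical in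
theorem probOptimal_eq (β : ℝ) (k₀ : V → C) (t : ℕ) :
    probOptimal G u hB β k₀ t =
      ∑ s with toProfile G s ∈ propFairOptima G u, (stateLaw G u hB β k₀ t s).toReal := by
  rw [probOptimal, profileLaw, PMF.toOuterMeasure_map_apply, PMF.toOuterMeasure_apply_fintype,
    ENNReal.toReal_sum, Finset.sum_filter]
  · refine Finset.sum_congr rfl fun s _ => ?_
    by_cases h : toProfile G s ∈ propFairOptima G u <;> simp [h, Set.indicator]
  · intro s _
    by_cases h : toProfile G s ∈ propFairOptima G u <;> simp [h, Set.indicator, PMF.apply_ne_top]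

theorem sum_toReal_eq_one {S : Type*} [Fintype S] (p : PMF S) : ∑ s, (p s).toReal = 1 := by
  rw [← ENNReal.toReal_sum fun s _ => p.apply_ne_top s, ← tsum_fintype (L := .unconditional _),
    p.tsum_coe, ENNReal.toReal_one]

theorem tendsto_stateLaw [Nonempty V] (hu : ∀ n k, 0 ≤ u n k) {β : ℝ} (hβ : 0 < β) {k₀ : V → C}
    (hk : ∀ n, 0 < u n (k₀ n)) (s : State C G) :
    Tendsto (fun t => (stateLaw G u hB β k₀ t s).toReal) atTop
      (𝓝 (prodRate G u s ^ β / ∑ s', prodRate G u s' ^ β)) := by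
  classical
  have hgibbs : ∀ s, (gibbs G u β s).toReal = prodRate G u s ^ β := fun s => by
    rw [gibbs, ← ENNReal.toReal_rpow, ENNReal.toReal_ofReal (prodRate_nonneg G hu s)]
  have hpos : ∀ s, 0 < prodRate G u s ^ β → 0 < prodRate G u s := fun s hs =>
    (prodRate_nonneg G hu s).lt_of_ne' fun h => hs.ne' (by rw [h, Real.zero_rpow hβ.ne'])
  have hreach : ∀ s, 0 < prodRate G u s → Relation.ReflTransGen
      (fun a b => 0 < (transition G u hB β a b).toReal) s
        (fun n => (k₀ n, Fin.last (G.degree n))) := fun s hs =>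
    Relation.ReflTransGen.mono (fun _ _ h => ENNReal.toReal_pos h (PMF.apply_ne_top _ _)) _ _
      (reflTransGen_last G hu hB hβ hk hs)
  have hlast : 0 < prodRate G u (fun n => (k₀ n, Fin.last (G.degree n))) :=
    prodRate_last_pos G hk
  refine tendsto_of_reversible (P := Matrix.of fun a b => (transition G u hB β a b).toReal)
    (W := fun s => prodRate G u s ^ β) (x := fun t s => (stateLaw G u hB β k₀ t s).toReal)
    (s₀ := fun n => (k₀ n, Fin.last (G.degree n))) ?_
    (fun s => Real.rpow_nonneg (prodRate_nonneg G hu s) β) ?_ (Real.rpow_pos_of_pos hlast β)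
    (ENNReal.toReal_pos (transition_self_ne_zero G hu hB hβ hlast) (PMF.apply_ne_top _ _))
    (fun s hs => hreach s (hpos s hs)) ?_ (sum_toReal_eq_one _) ?_ s
  · refine ⟨fun a b => ENNReal.toReal_nonneg, ?_⟩
    ext a
    simpa [Matrix.mulVec, dotProduct] using sum_toReal_eq_one (transition G u hB β a)
  · intro a b
    simp only [Matrix.of_apply, ← hgibbs, ← ENNReal.toReal_mul]
    rw [gibbs_mul_transition_comm G hu hB hβ]
  · intro t
    ext b
    change ((stateLaw G u hB β k₀ t).bind (transition G u hB β) b).toReal =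
      ∑ a, (stateLaw G u hB β k₀ t a).toReal * (transition G u hB β a b).toReal
    rw [PMF.bind_apply, tsum_fintype, ENNReal.toReal_sum fun a _ =>
      ENNReal.mul_ne_top (PMF.apply_ne_top _ _) (PMF.apply_ne_top _ _)]
    simp only [ENNReal.toReal_mul]
  · intro a ha
    have hne : a ≠ initState G k₀ := by
      rintro rfl
      exact (Real.rpow_pos_of_pos (prodRate_initState_pos G hk) β).ne' ha
    simp [stateLaw, hne]

theorem tendsto_probOptimal_of_forall_mem
    (h : ∀ s : State C G, toProfile G s ∈ propFairOptima G u) (β : ℝ) (k₀ : V → C) :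
    Tendsto (probOptimal G u hB β k₀) atTop (𝓝 1) := by
  classical
  refine tendsto_const_nhds.congr fun t => ?_
  rw [probOptimal_eq, Finset.filter_true_of_mem fun s _ => h s, sum_toReal_eq_one]

end Limit

end AlohaFairness

end

/-! ### The choice of β and the degenerate cases -/

open AlohaFairness in
theorem mainTheorem1 {V C : Type*} [Fintype V] [DecidableEq V] [Fintype C] [DecidableEq C]
    [Nonempty C] (G : SimpleGraph V) [DecidableRel G.Adj] (u : V → C → ℝ)
    (hu : ∀ n k, 0 ≤ u n k) {B : ℝ} (hB : 0 < B) (ε : ℝ) (hε : 0 < ε) :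
    ∃ β : ℝ, 0 < β ∧ ∀ k₀ : V → C, (∀ n k, u n k ≤ u n (k₀ n)) →
      ∃ L : ℝ, Filter.Tendsto (AlohaFairness.probOptimal G u hB β k₀) Filter.atTop (nhds L) ∧
        1 - ε ≤ L := by
  classical
  -- If there are no users, or some user has only zero rates, then all states are optimal and the
  -- probability is constantly 1. Otherwise the maximal product of rates is positive.
  by_cases htriv : ∀ s : State C G, toProfile G s ∈ propFairOptima G u
  · exact ⟨1, one_pos, fun k₀ _ => ⟨1, tendsto_probOptimal_of_forall_mem G hB htriv 1 k₀,
      by linarith⟩⟩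
  have hV : Nonempty V := by
    by_contra hV
    rw [not_nonempty_iff] at hV
    exact htriv fun s => toProfile_mem_propFairOptima G hu fun t => by rw [Subsingleton.elim t s]
  have hpos : ∀ n, ∃ k, 0 < u n k := by
    by_contra! h
    obtain ⟨n, hn⟩ := h
    have h0 : ∀ s : State C G, prodRate G u s = 0 := fun s =>
      Finset.prod_eq_zero (Finset.mem_univ n) (by
        rw [rate, le_antisymm (hn _) (hu n _), mul_zero, zero_mul])
    exact htriv fun s => toProfile_mem_propFairOptima G hu fun t => by rw [h0, h0]
  obtain ⟨s₀, hs₀⟩ := Finite.exists_max (prodRate (C := C) G u)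
  have hs₀pos : 0 < prodRate G u s₀ := by
    choose k hk using hpos
    exact (prodRate_initState_pos G hk).trans_le (hs₀ _)
  -- The Gibbs limit does not depend on the initial channels, so β can be fixed before `k₀`.
  obtain ⟨β, hβ₁, hβ⟩ := ((eventually_one_sub_le_sum_rpow_div (prodRate_nonneg G hu) hs₀pos
    (Finset.univ.filter fun s => toProfile G s ∈ propFairOptima G u)
    (fun s hs => (hs₀ s).lt_of_ne fun h => hs (by
      simpa using toProfile_mem_propFairOptima G hu fun t => h ▸ hs₀ t)) hε).and
    (Filter.eventually_gt_atTop 0)).exists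
  refine ⟨β, hβ, fun k₀ hk₀ => ⟨_, ?_, hβ₁⟩⟩
  simp only [funext (probOptimal_eq G hB β k₀)]
  refine tendsto_finsetSum _ fun s _ => tendsto_stateLaw G hB hu hβ (fun n => ?_) s
  obtain ⟨k, hk⟩ := hpos n
  exact hk.trans_le (hk₀ n k)
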